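/- All trees are finite, rooted and unordered, and each node $u$ carries a label $\overline u$ from an arbitrary set; $\#T$ is the number of nodes of $T$ and $T(v)$ is the subtree of $T$ made of $v$ and all its descendants. Write $T_1\simeq T_2$ if there is a tree isomorphism, i.e. a bijection $\varphi:T_1\to T_2$ of the nodes such that $u$ is a child of $v$ if and only if $\varphi(u)$ is a child of $\varphi(v)$ (labels are ignored). A tree isomorphism $\varphi$ is a tree ciphering if the relation $\{(\overline u,\overline{\varphi(u)}):u\in T_1\}$ is (the graph of) a bijection $f_\varphi$, called its cipher, between the label sets of $T_1$ and $T_2$; write $T_1\sim T_2$ if a tree ciphering exists. Let $\mathfrak R_\simeq(T)$ be the directed multigraph whose vertices are the $\simeq$-classes $[u]_\simeq$ of the subtrees $T(u)$ of $T$, with as many edges from $[u]_\simeq$ to $q$ as $u$ has children of class $q$; its source is the class of $T$. Consider the following algorithm DAG-RW. Its input is $T$ and $\mathfrak R_\simeq(T)$; it uses as a subroutine an algorithm which, given topologically isomorphic trees $T_1\simeq T_2$, decides whether $T_1\sim T_2$ and, if so, returns the cipher of some tree ciphering from $T_1$ to $T_2$. Initialise $R$ as $\mathfrak R_\simeq(T)$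 and $s$ as the empty map from vertices of $R$ to nodes of $T$. Traverse the original vertices $q$ of $R$ breadth-first from the source, where a vertex enters the queue once all its incoming edges have been scanned (so it is treated after all its parents), and for each of them do the following. (1) Let $A_q$ be $\{\mathrm{root}(T)\}$ if $q$ is the source, and otherwise the union over all edges $(p,q)$ of $R$ of the sets of children $u$ of $s(p)$ with $[u]_\simeq=q$. (2) Partition $A_q$: treat the $u\in A_q$ one after the other, and run the subroutine on $T(\sigma(P))$ and $T(u)$ for the parts $P$ found so far, where $\sigma(P)$ is the representative of $P$, until $T(u)\sim T(\sigma(P))$ for one of them; then add $u$ to this $P$ and store the related cipher $f_{\sigma(P),u}$. If there is no such part, create the new part $P=\{u\}$ with $\sigma(P)=u$ (the cipher $f_{u,u}$ being the identity). (3) For each part $P$, add to $R$ a new vertex $r_P$ with label $\overline{\sigma(P)}$, identified as the $\sim$-class of $\sigma(P)$; add an edge from $r_P$ to $c$ for each edge $(q,c)$ of $R$; for each $u\in P$ that has a parent, add an edge with label $f_{\sigma(P),u}$ from the vertex identified as the $\sim$-class of the parent of $u$ to $r_P$; and set $s(r_P)=\sigma(P)$. (4) Delete the vertex $q$ and the edges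 at $q$. Finally return $R$. Running time is counted in elementary steps of a random access machine (access to one table entry, inspection or creation of one edge, copy of one pair of a cipher, and the like), plus the steps of each call of the subroutine, each call taking at least one step. Let $C_\sim(k)$ be a bound on the number of steps of the subroutine on topologically isomorphic trees of size $k$. There is a universal constant $K$ such that the following holds for every such subroutine and every such bound $C_\sim$. Let $T$ be a labelled tree with exactly $n$ distinct subtrees up to $\simeq$, the $i$-th one having $s_i$ nodes and appearing $n_i$ times in $T$ (i.e. as $T(v)$, up to $\simeq$, for exactly $n_i$ nodes $v$). Then DAG-RW on $T$ takes at most $$K\cdot \#T\sum_{i=1}^n n_i\,C_\sim(s_i)$$ steps; that is, its time-complexity is $O\big(\#T\sum_{i=1}^n n_iC_\sim(s_i)\big)$. -/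

import Mathlib

universe u

/-! ## Labelled rooted trees -/

/-- A finite rooted tree whose nodes carry labels in `α`. The children of a node are stored in a
list; the order of that list plays no role in any notion of isomorphism below. -/
structure LTree (α : Type u) where
  Node : Type
  fintypeNode : Fintype Node
  root : Node
  children : Node → List Node
  label : Node → α
  nodup_children : ∀ v, (children v).Nodup
  root_not_child : ∀ v, root ∉ children v
  parent_unique : ∀ {u v w}, u ∈ children v → u ∈ children w → v = w
  reachable : ∀ v, Relation.ReflTransGen (fun a b => b ∈ children a) root v

attribute [instance] LTree.fintypeNode

namespace LTree

variable {α : Type u}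

/-- `#T`. -/
def size (T : LTree α) : ℕ := Fintype.card T.Node

/-- `T.Desc v w`: the node `w` is `v` or a descendant of `v`. -/
def Desc (T : LTree α) (v w : T.Node) : Prop :=
  Relation.ReflTransGen (fun a b => b ∈ T.children a) v w

theorem no_cycle (T : LTree α) (v : T.Node) :
    ¬ Relation.TransGen (fun a b => b ∈ T.children a) v v := by
  induction T.reachable v with
  | refl =>
    intro h
    obtain ⟨c, -, hc⟩ := Relation.TransGen.tail'_iff.1 h
    exact T.root_not_child c hc
  | tail _ hbc ih =>
    intro h
    obtain ⟨c, h1, hc⟩ := Relation.TransGen.tail'_iff.1 h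
    obtain rfl := T.parent_unique hbc hc
    exact ih (Relation.TransGen.head' hbc h1)

open scoped Classical in
/-- The parent of a node; `none` for the root. -/
noncomputable def parent (T : LTree α) (u : T.Node) : Option T.Node :=
  if h : ∃ v, u ∈ T.children v then some h.choose else none

open scoped Classical in
/-- `T(v)`: the subtree made of `v` and all its descendants. -/
noncomputable def subtree (T : LTree α) (v : T.Node) : LTree α where
  Node := {w : T.Node // T.Desc v w}
  fintypeNode := inferInstance
  root := ⟨v, Relation.ReflTransGen.refl⟩
  children w := (T.children w.1).pmap (fun u hu => ⟨u, hu⟩)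
    (fun _ hu => Relation.ReflTransGen.tail w.2 hu)
  label w := T.label w.1
  nodup_children w := (T.nodup_children w.1).pmap (fun _ _ _ _ h => congrArg Subtype.val h)
  root_not_child w h := by
    obtain ⟨u, hu, he⟩ := List.mem_pmap.1 h
    have he' : u = v := congrArg Subtype.val he
    subst he'
    exact T.no_cycle u (Relation.TransGen.tail' w.2 hu)
  parent_unique := by
    intro u v w hv hw
    obtain ⟨a, ha, hau⟩ := List.mem_pmap.1 hv
    obtain ⟨b, hb, hbu⟩ := List.mem_pmap.1 hw
    have hab : a = b := congrArg Subtype.val (hau.trans hbu.symm)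
    subst hab
    exact Subtype.ext (T.parent_unique ha hb)
  reachable := by
    rintro ⟨w, hw⟩
    induction hw with
    | refl => exact Relation.ReflTransGen.refl
    | tail h1 h2 ih =>
      exact Relation.ReflTransGen.tail ih (List.mem_pmap.2 ⟨_, h2, rfl⟩)

/-- The alphabet of `T`. -/
def alphabet (T : LTree α) : Set α := Set.range T.label

/-- A bijection between the nodes of two trees is a tree isomorphism. -/
def IsTreeIso {T₁ T₂ : LTree α} (φ : T₁.Node ≃ T₂.Node) : Prop :=
  ∀ u v, u ∈ T₁.children v ↔ φ u ∈ T₂.children (φ v)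

/-- `T₁ ≃ T₂`: same topology. -/
def TopIso (T₁ T₂ : LTree α) : Prop := ∃ φ : T₁.Node ≃ T₂.Node, IsTreeIso φ

/-- The relation between labels induced by a bijection between the nodes. -/
def labelRel {T₁ T₂ : LTree α} (φ : T₁.Node ≃ T₂.Node) (x y : α) : Prop :=
  ∃ u, x = T₁.label u ∧ y = T₂.label (φ u)

/-- A tree isomorphism is a tree ciphering if the induced relation between the two alphabets
is a bijection. -/
def IsTreeCiphering {T₁ T₂ : LTree α} (φ : T₁.Node ≃ T₂.Node) : Prop :=
  IsTreeIso φ ∧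
    (∀ x ∈ T₁.alphabet, ∃! y, y ∈ T₂.alphabet ∧ labelRel φ x y) ∧
    (∀ y ∈ T₂.alphabet, ∃! x, x ∈ T₁.alphabet ∧ labelRel φ x y)

/-- `T₁ ∼ T₂`: there is a tree ciphering from `T₁` to `T₂`. -/
def CipherIso (T₁ T₂ : LTree α) : Prop := ∃ φ : T₁.Node ≃ T₂.Node, IsTreeCiphering φ

theorem TopIso.refl (T : LTree α) : TopIso T T := ⟨Equiv.refl _, fun _ _ => Iff.rfl⟩

theorem TopIso.symm {T₁ T₂ : LTree α} : TopIso T₁ T₂ → TopIso T₂ T₁ := by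
  rintro ⟨φ, h⟩
  exact ⟨φ.symm, fun u v => by simpa using (h (φ.symm u) (φ.symm v)).symm⟩

theorem TopIso.trans {T₁ T₂ T₃ : LTree α} : TopIso T₁ T₂ → TopIso T₂ T₃ → TopIso T₁ T₃ := by
  rintro ⟨φ, h⟩ ⟨ψ, k⟩
  exact ⟨φ.trans ψ, fun u v => (h u v).trans (k (φ u) (φ v))⟩

/-- Nodes of `T` are equivalent when their subtrees have the same topology. -/
def topSetoid (T : LTree α) : Setoid T.Node where
  r u v := TopIso (T.subtree u) (T.subtree v)
  iseqv := ⟨fun _ => TopIso.refl _, TopIso.symm, TopIso.trans⟩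

/-! ## The topological DAG compression of a tree -/

/-- The vertices of the topological compression of `T`: the classes `[u]` of its subtrees. -/
def TopClass (T : LTree α) : Type := Quotient T.topSetoid

instance (T : LTree α) : Finite T.TopClass :=
  inferInstanceAs (Finite (Quotient T.topSetoid))

noncomputable instance (T : LTree α) : Fintype T.TopClass := Fintype.ofFinite _

/-- The class of the subtree rooted at `u`. -/
def topClass (T : LTree α) (u : T.Node) : T.TopClass := Quotient.mk T.topSetoid u

noncomputable def topVertices (T : LTree α) : List T.TopClass := Finset.univ.toList

/-- The targets of the edges that leave the vertex `q`, with multiplicity: one edge for each child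
of a node chosen in the class `q`. -/
noncomputable def topOut (T : LTree α) (q : T.TopClass) : List T.TopClass :=
  (T.children (Quotient.out (s := T.topSetoid) q)).map T.topClass

/-- All edges of the topological compression, with multiplicity. -/
noncomputable def topEdges (T : LTree α) : List (T.TopClass × T.TopClass) :=
  T.topVertices.flatMap fun q => (T.topOut q).map fun c => (q, c)

/-- The source of the topological compression: the class of the whole tree. -/
def topSource (T : LTree α) : T.TopClass := T.topClass T.root

end LTree

/-! ## Computations with a step count -/

/-- A result together with the number of elementary steps spent on it. -/
structure Timed (β : Type u) where
  val : β
  time : ℕ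

namespace Timed

/-- Sequential composition: the step counts add up. -/
def bind {β : Type*} {γ : Type*} (x : Timed β) (f : β → Timed γ) : Timed γ :=
  ⟨(f x.val).val, x.time + (f x.val).time⟩

/-- Spend `k` elementary steps. -/
def tick (k : ℕ) : Timed PUnit.{u + 1} := ⟨PUnit.unit, k⟩

instance : Monad Timed.{u} where
  pure b := ⟨b, 0⟩
  bind := Timed.bind

end Timed

/-- A cipher, stored as the table of its pairs `(x, f x)`. -/
abbrev Cipher (α : Type u) : Type u := Finset (α × α)

/-- An algorithm for the tree ciphering isomorphism problem on topologically isomorphic trees: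
it returns the cipher of some tree ciphering if there is one and `none` if there is none,
and it counts its steps. -/
structure CipherTest (α : Type u) where
  run : LTree α → LTree α → Timed (Option (Cipher α))
  sound : ∀ T₁ T₂ f, LTree.TopIso T₁ T₂ → (run T₁ T₂).val = some f →
    ∃ φ : T₁.Node ≃ T₂.Node, LTree.IsTreeCiphering φ ∧
      ∀ x y, (x, y) ∈ f ↔ LTree.labelRel φ x y
  complete : ∀ T₁ T₂, LTree.CipherIso T₁ T₂ → (run T₁ T₂).val.isSome
  one_le_time : ∀ T₁ T₂, LTree.TopIso T₁ T₂ → 1 ≤ (run T₁ T₂).time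

/-- On topologically isomorphic trees of size `k` the test makes at most `C k` steps. -/
def CipherTest.CostAtMost {α : Type u} (test : CipherTest α) (C : ℕ → ℕ) : Prop :=
  ∀ T₁ T₂ : LTree α, LTree.TopIso T₁ T₂ → (test.run T₁ T₂).time ≤ C T₁.size

/-! ## The algorithm

Elementary steps are those of a random access machine: following a pointer, reading or writing one
entry of a table indexed by nodes or vertices, inspecting or adding one edge, copying one pair of
a cipher. Enumerating the edges at a vertex is done by scanning the whole list of edges. -/

namespace DagRW

variable {α : Type u}

/-! ### Order of the vertices

A breadth-first traversal of the topological compression from its source. A vertex enters the queue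
when the last of its incoming edges has been scanned, so that it comes after all its parents. -/

/-- `count c` is the number of edges into `c` that have not been scanned yet. -/
structure QueueState (T : LTree α) where
  count : T.TopClass → ℕ
  queue : List T.TopClass

open scoped Classical in
noncomputable def scanEdge {T : LTree α} (S : QueueState T) (c : T.TopClass) :
    Timed (QueueState T) := do
  Timed.tick 2
  let S' := { S with count := Function.update S.count c (S.count c - 1) }
  if S.count c = 1 then
    Timed.tick 1
    return { S' with queue := S'.queue ++ [c] }
  else
    return S'

/-- The main loop of the traversal; `fuel` bounds the number of iterations. -/
noncomputable def traverse {T : LTree α} :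
    (fuel : ℕ) → QueueState T → Timed (List T.TopClass)
  | 0, _ => pure []
  | fuel + 1, S =>
    match S.queue with
    | [] => pure []
    | q :: rest => do
      Timed.tick 1
      let S' ← (T.topOut q).foldlM scanEdge { S with queue := rest }
      let order ← traverse fuel S'
      return q :: order

open scoped Classical in
/-- Compute the number of edges into every vertex, one step per vertex and per edge. -/
noncomputable def inDegrees (T : LTree α) : Timed (T.TopClass → ℕ) := do
  Timed.tick T.topVertices.length
  T.topEdges.foldlM (fun d e => do
    Timed.tick 1
    return Function.update d e.2 (d e.2 + 1)) (fun _ => 0)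

noncomputable def order (T : LTree α) : Timed (List T.TopClass) := do
  let d ← inDegrees T
  Timed.tick 1
  traverse T.topVertices.length { count := d, queue := [T.topSource] }

/-! ### The edited graph -/

/-- Vertices of the graph `R`: those of the topological compression that have not been processed
yet, and the new vertices `r_P`; the vertex `r_P` is named by the representative of `P`. -/
inductive Vertex (T : LTree α) : Type
  | top (q : T.TopClass)
  | new (v : T.Node)

/-- An edge of `R`, with its cipher once it has one. -/
structure Edge (T : LTree α) : Type u where
  src : Vertex T
  tgt : Vertex T
  cipher : Option (Cipher α)

/-- The graph `R` (vertices, multiset of edges, vertex labels), the section `s`, and the table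
`ident` with `ident v = some r` once the vertex `r` of `R` has been identified as the class of
`v` for tree ciphering. -/
structure Graph (T : LTree α) : Type u where
  vertices : List (Vertex T)
  edges : List (Edge T)
  label : Vertex T → Option α
  sec : Vertex T → Option T.Node
  ident : T.Node → Option (Vertex T)

/-- Initialise `R` as the topological compression and `s` as the empty map. -/
noncomputable def init (T : LTree α) : Timed (Graph T) := do
  Timed.tick (T.topVertices.length + T.topEdges.length)
  return {
    vertices := T.topVertices.map Vertex.top
    edges := T.topEdges.map fun e => ⟨Vertex.top e.1, Vertex.top e.2, none⟩
    label := fun _ => none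
    sec := fun _ => none
    ident := fun _ => none }

/-! ### The set `A_q` -/

open scoped Classical in
/-- Add to `A` the children of `v` of topological class `q`. Membership in `A` is read off
a table of marks on the nodes. -/
noncomputable def collectChildren {T : LTree α} (q : T.TopClass) (A : List T.Node) (v : T.Node) :
    Timed (List T.Node) :=
  (T.children v).foldlM (fun A u => do
    Timed.tick 2
    if T.topClass u = q ∧ u ∉ A then
      Timed.tick 2
      return u :: A
    else
      return A) A

open scoped Classical in
/-- The set `A_q`: the root if `q` is the source, otherwise the union over the edges `(p, q)`
of `R` of the sets of children of `s(p)` of topological class `q`. -/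
noncomputable def collect {T : LTree α} (R : Graph T) (q : T.TopClass) : Timed (List T.Node) := do
  Timed.tick 1
  if q = T.topSource then
    return [T.root]
  else
    R.edges.foldlM (fun A e => do
      Timed.tick 1
      if e.tgt = Vertex.top q then
        Timed.tick 1
        match R.sec e.src with
        | none => return A
        | some v => collectChildren q A v
      else
        return A) []

/-! ### The partition of `A_q` -/

/-- An element `P` of the partition: its representative `σ(P)` and its members `u`, each with
the cipher of a tree ciphering from the subtree of `σ(P)` to that of `u`. -/
structure Block (T : LTree α) : Type u where
  rep : T.Node
  members : List (T.Node × Cipher α)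

open scoped Classical in
/-- The identity cipher of the subtree rooted at `u`. -/
noncomputable def idCipher (T : LTree α) (u : T.Node) : Cipher α :=
  (Finset.univ : Finset (T.subtree u).Node).image
    fun w => ((T.subtree u).label w, (T.subtree u).label w)

/-- Put `u` into the first block whose representative has a subtree equivalent to that of `u` for
tree ciphering, or into a new block of which it is the representative. -/
noncomputable def insertBlock {T : LTree α} (test : CipherTest α) (u : T.Node) :
    List (Block T) → Timed (List (Block T))
  | [] => do
    Timed.tick (3 + (T.subtree u).size)
    return [{ rep := u, members := [(u, idCipher T u)] }]
  | B :: Bs => do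
    Timed.tick 1
    match ← test.run (T.subtree B.rep) (T.subtree u) with
    | some f =>
      Timed.tick (1 + f.card)
      return { B with members := B.members ++ [(u, f)] } :: Bs
    | none =>
      let Bs' ← insertBlock test u Bs
      return B :: Bs'

noncomputable def partition {T : LTree α} (test : CipherTest α) (A : List T.Node) :
    Timed (List (Block T)) :=
  A.foldlM (fun Bs u => do
    Timed.tick 1
    insertBlock test u Bs) []

/-! ### Replacing a vertex -/

open scoped Classical in
/-- Add to `R` the new vertex `r_P`, with copies of the edges that leave `q` and with an edge
from the class of the parent of each member of `P`. -/
noncomputable def addBlock {T : LTree α} (q : T.TopClass) (R : Graph T) (P : Block T) :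
    Timed (Graph T) := do
  let r : Vertex T := Vertex.new P.rep
  Timed.tick 3
  let R₁ : Graph T := { R with
    vertices := r :: R.vertices
    label := Function.update R.label r (some (T.label P.rep))
    ident := Function.update R.ident P.rep (some r) }
  let R₂ ← R₁.edges.foldlM (fun R' e => do
    Timed.tick 1
    if e.src = Vertex.top q then
      Timed.tick 1
      return { R' with edges := ⟨r, e.tgt, none⟩ :: R'.edges }
    else
      return R') R₁
  let R₃ ← P.members.foldlM (fun R' m => do
    Timed.tick 2
    match (T.parent m.1).bind R'.ident with
    | none => return R'
    | some p =>
      Timed.tick (1 + m.2.card)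
      return { R' with edges := ⟨p, r, some m.2⟩ :: R'.edges }) R₂
  Timed.tick 1
  return { R₃ with sec := Function.update R₃.sec r (some P.rep) }

open scoped Classical in
/-- Delete the vertex `q` and the edges at `q`. -/
noncomputable def deleteVertex {T : LTree α} (q : T.TopClass) (R : Graph T) :
    Timed (Graph T) := do
  Timed.tick (R.vertices.length + R.edges.length)
  return { R with
    vertices := R.vertices.filter fun v => v ≠ Vertex.top q
    edges := R.edges.filter fun e => e.src ≠ Vertex.top q ∧ e.tgt ≠ Vertex.top q }

/-- One iteration of the main loop. -/
noncomputable def processVertex {T : LTree α} (test : CipherTest α) (R : Graph T)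
    (q : T.TopClass) : Timed (Graph T) :=
  (collect R q).bind fun A => do
    Timed.tick 1
    let Ps ← partition test A
    let R' ← Ps.foldlM (addBlock q) R
    deleteVertex q R'

/-- The DAG-RW compression algorithm, on the input `T` together with its topological
compression, with `test` as the subroutine for tree ciphering isomorphism. -/
noncomputable def dagRW (test : CipherTest α) (T : LTree α) : Timed (Graph T) :=
  (order T).bind fun qs => do
    let R ← init T
    qs.foldlM (processVertex test) R

end DagRW

/-!
Write `N = #T`, let `m` be the number of nodes in a class `q` of subtrees, `d` the number of edges
that leave `q` in the topological compression, and `c` the value of `C` at the common size of the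
subtrees in `q`. Grouping the nodes of `T` by class turns `∑ m i * C (s i)` into the sum of
`C (#T(v))` over all nodes `v`. Every call of the test takes a step, so this sum is at least `N`,
and the claimed bound dominates `N * N`. It therefore pays for `O(N)` steps per class or per node,
and it remains to see that nothing else costs more.

* The traversal outputs each class at most once (`order_spec`): a vertex is queued when its count of
  unscanned edges drops from one to zero, and a count that is zero never changes again. Only this
  property of the order is needed, not that parents come first.
* The set `A_q` has no repetition and lies in the class `q` (`collect_spec`), so it has at most `m`
  elements, each compared with at most `m` representatives. The tests at `q` cost at most
  `m * m * c ≤ N * (m * c)` (`partition_spec`). A cipher has at most one pair for each node, so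
  storing or copying one costs `O(N)`.
* The graph stays small (`Graph.LoopInv`): processing `q` adds at most `m` vertices, one edge for
  each element of `A_q`, and one copy of the `d` edges that leave `q` for each block. As isomorphic
  trees have the same number of children at their roots, the sum of `m * d` over the classes counts
  the pairs of a parent and a child in `T`, so it is at most `N`, and there are never more than
  `3 * N` edges. Hence every scan of the edge list costs `O(N)`.
* Collecting `A_q` explores, for each edge that enters `q`, the children of one node, which costs
  `O(N)` per edge. These edges are deleted with `q`, so the number `pendingCount` of edges that
  enter an unprocessed vertex is a potential that pays for them (`processVertex_spec`).
-/

/-! ### Step counts of monadic folds -/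

namespace Timed

@[simp] theorem val_bind {β γ : Type u} (x : Timed β) (f : β → Timed γ) :
    (x >>= f).val = (f x.val).val := rfl

@[simp] theorem time_bind {β γ : Type u} (x : Timed β) (f : β → Timed γ) :
    (x >>= f).time = x.time + (f x.val).time := rfl

@[simp] theorem val_pure {β : Type u} (b : β) : (pure b : Timed β).val = b := rfl

@[simp] theorem time_pure {β : Type u} (b : β) : (pure b : Timed β).time = 0 := rfl

@[simp] theorem time_tick (k : ℕ) : (tick.{u} k).time = k := rfl

-- The monad instance stays in one universe; the main loop calls `Timed.bind` across universes.
@[simp] theorem val_bind_fun {β : Type*} {γ : Type*} (x : Timed β) (f : β → Timed γ) :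
    (x.bind f).val = (f x.val).val := rfl

@[simp] theorem time_bind_fun {β : Type*} {γ : Type*} (x : Timed β) (f : β → Timed γ) :
    (x.bind f).time = x.time + (f x.val).time := rfl

/-- If each step of a fold preserves `Inv` and the step at `c` costs at most `cost c`, then the
fold preserves `Inv` and its cost is at most the sum of the costs of its steps. -/
theorem foldlM_inv {β : Type u} {γ : Type*} {f : β → γ → Timed β} (Inv : β → Prop)
    (cost : γ → ℕ) (l : List γ)
    (h : ∀ b, Inv b → ∀ c ∈ l, Inv (f b c).val ∧ (f b c).time ≤ cost c) (b : β) (hb : Inv b) :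
    Inv (l.foldlM f b).val ∧ (l.foldlM f b).time ≤ (l.map cost).sum := by
  induction l generalizing b with
  | nil => simpa using hb
  | cons c l ih =>
    obtain ⟨h1, h2⟩ := h b hb c (by simp)
    obtain ⟨h3, h4⟩ := ih (fun b hb c hc => h b hb c (by simp [hc])) _ h1
    simp only [List.foldlM_cons, val_bind, time_bind, List.map_cons, List.sum_cons]
    exact ⟨h3, by omega⟩

end Timed

/-! ### Invariants of the topology of a tree -/

namespace LTree

variable {α : Type u}

theorem one_le_size (T : LTree α) : 1 ≤ T.size := Fintype.card_pos_iff.2 ⟨T.root⟩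

theorem length_le_size {T : LTree α} {l : List T.Node} (h : l.Nodup) : l.length ≤ T.size :=
  h.length_le_card

theorem size_subtree_le (T : LTree α) (v : T.Node) : (T.subtree v).size ≤ T.size := by
  classical
  exact Fintype.card_le_of_injective (fun w : (T.subtree v).Node => w.1) Subtype.val_injective

theorem TopIso.size_eq {T₁ T₂ : LTree α} (h : TopIso T₁ T₂) : T₁.size = T₂.size :=
  Fintype.card_congr h.choose

theorem exists_parent (T : LTree α) {v : T.Node} (h : v ≠ T.root) : ∃ w, v ∈ T.children w := by
  rcases Relation.ReflTransGen.cases_tail (T.reachable v) with h' | ⟨w, -, hw⟩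
  · exact absurd h' h
  · exact ⟨w, hw⟩

theorem IsTreeIso.map_root {T₁ T₂ : LTree α} {φ : T₁.Node ≃ T₂.Node} (h : IsTreeIso φ) :
    φ T₁.root = T₂.root := by
  by_contra hne
  obtain ⟨w, hw⟩ := T₂.exists_parent hne
  exact T₁.root_not_child (φ.symm w) ((h _ _).2 (by simpa using hw))

theorem TopIso.length_children_root {T₁ T₂ : LTree α} (h : TopIso T₁ T₂) :
    (T₁.children T₁.root).length = (T₂.children T₂.root).length := by
  obtain ⟨φ, h⟩ := h
  rw [← List.length_map φ]
  refine List.Perm.length_eq ((List.perm_ext_iff_of_nodup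
    ((T₁.nodup_children _).map φ.injective) (T₂.nodup_children _)).2 fun x => ?_)
  rw [← φ.apply_symm_apply x, List.mem_map_of_injective φ.injective, h, h.map_root]

theorem topClass_eq_iff {T : LTree α} {u v : T.Node} :
    T.topClass u = T.topClass v ↔ TopIso (T.subtree u) (T.subtree v) :=
  Quotient.eq (r := T.topSetoid)

theorem topClass_out (T : LTree α) (q : T.TopClass) :
    T.topClass (Quotient.out (s := T.topSetoid) q) = q := Quotient.out_eq (s := T.topSetoid) q

theorem length_children_subtree_root (T : LTree α) (v : T.Node) :
    ((T.subtree v).children (T.subtree v).root).length = (T.children v).length :=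
  List.length_pmap

/-- The number of children of `v` depends only on its class. -/
theorem length_children (T : LTree α) (v : T.Node) :
    (T.children v).length = (T.topOut (T.topClass v)).length := by
  have h := (topClass_eq_iff.1 (T.topClass_out (T.topClass v))).length_children_root
  rw [length_children_subtree_root, length_children_subtree_root] at h
  rw [topOut, List.length_map, h]

/-- The number of nodes of `T` in the class `q`. -/
noncomputable def classCard (T : LTree α) (q : T.TopClass) : ℕ := by
  classical
  exact (Finset.univ.filter fun v => T.topClass v = q).card

/-- The number of edges that leave the vertex `q` of the topological compression. -/
noncomputable def outDeg (T : LTree α) (q : T.TopClass) : ℕ := (T.topOut q).length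

/-- The common size of the subtrees in the class `q`. -/
noncomputable def classSize (T : LTree α) (q : T.TopClass) : ℕ :=
  (T.subtree (Quotient.out (s := T.topSetoid) q)).size

theorem classSize_topClass (T : LTree α) (v : T.Node) :
    T.classSize (T.topClass v) = (T.subtree v).size :=
  (topClass_eq_iff.1 (T.topClass_out (T.topClass v))).size_eq

/-- Summing over the classes with multiplicity amounts to summing over the nodes. -/
theorem sum_classCard_mul (T : LTree α) (F : T.TopClass → ℕ) :
    ∑ q, T.classCard q * F q = ∑ v, F (T.topClass v) := by
  classical
  rw [← Finset.sum_fiberwise_of_maps_to (g := T.topClass) (t := Finset.univ) (by simp)]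
  refine Finset.sum_congr rfl fun q _ => ?_
  rw [Finset.sum_congr rfl (g := fun _ => F q)]
  · rw [Finset.sum_const, smul_eq_mul, classCard]
  · intro v hv
    rw [(Finset.mem_filter.1 hv).2]

theorem sum_classCard (T : LTree α) : ∑ q, T.classCard q = T.size := by
  simpa [size] using T.sum_classCard_mul fun _ => 1

theorem one_le_classCard (T : LTree α) (q : T.TopClass) : 1 ≤ T.classCard q := by
  classical
  exact Finset.card_pos.2 ⟨_, Finset.mem_filter.2 ⟨Finset.mem_univ _, T.topClass_out q⟩⟩

theorem classCard_le (T : LTree α) (q : T.TopClass) : T.classCard q ≤ T.size := by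
  classical
  exact Finset.card_le_univ _

theorem length_le_classCard {T : LTree α} {q : T.TopClass} {l : List T.Node} (h : l.Nodup)
    (hq : ∀ u ∈ l, T.topClass u = q) : l.length ≤ T.classCard q := by
  classical
  rw [← List.toFinset_card_of_nodup h]
  refine Finset.card_le_card fun u hu => ?_
  simpa using hq u (by simpa using hu)

/-- Every node is the child of at most one node. -/
theorem sum_length_children_le (T : LTree α) : ∑ v, (T.children v).length ≤ T.size := by
  classical
  rw [Finset.sum_congr rfl fun v _ => (List.toFinset_card_of_nodup (T.nodup_children v)).symm,
    ← Finset.card_biUnion]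
  · exact Finset.card_le_univ _
  · intro v _ w _ hvw
    refine Finset.disjoint_left.2 fun u hv hw => hvw ?_
    exact T.parent_unique (List.mem_toFinset.1 hv) (List.mem_toFinset.1 hw)

theorem sum_classCard_mul_outDeg_le (T : LTree α) :
    ∑ q, T.classCard q * T.outDeg q ≤ T.size := by
  rw [T.sum_classCard_mul T.outDeg]
  simpa only [outDeg, ← length_children] using T.sum_length_children_le

theorem sum_outDeg_le (T : LTree α) : ∑ q, T.outDeg q ≤ T.size :=
  (Finset.sum_le_sum fun q _ => Nat.le_mul_of_pos_left _ (T.one_le_classCard q)).trans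
    T.sum_classCard_mul_outDeg_le

theorem outDeg_le (T : LTree α) (q : T.TopClass) : T.outDeg q ≤ T.size := by
  rw [outDeg, topOut, List.length_map]
  exact length_le_size (T.nodup_children _)

theorem length_topVertices (T : LTree α) : T.topVertices.length ≤ T.size := by
  rw [← T.sum_classCard, topVertices, Finset.length_toList, Finset.card_eq_sum_ones]
  exact Finset.sum_le_sum fun q _ => T.one_le_classCard q

theorem length_topEdges (T : LTree α) : T.topEdges.length ≤ T.size := by
  refine le_trans (le_of_eq ?_) T.sum_outDeg_le
  simp [topEdges, topVertices, outDeg, List.length_flatMap, ← Finset.sum_map_toList]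

open scoped Classical in
theorem countP_topEdges (T : LTree α) (p : T.TopClass) :
    T.topEdges.countP (fun e => e.1 = p) = T.outDeg p := by
  have h : ∀ q, ((T.topOut q).map fun c => (q, c)).countP (fun e => e.1 = p) =
      if q = p then T.outDeg q else 0 := by
    intro q
    split_ifs with h <;> simp [List.countP_map, Function.comp_def, h, outDeg]
  rw [topEdges, List.countP_flatMap, topVertices]
  simp only [Function.comp_def, h, Finset.sum_map_toList, Finset.sum_ite_eq', Finset.mem_univ,
    if_true]

theorem sum_map_le_sum (T : LTree α) {l : List T.TopClass} (h : l.Nodup) (F : T.TopClass → ℕ) :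
    (l.map F).sum ≤ ∑ q, F q := by
  classical
  rw [← List.sum_toFinset F h]
  exact Finset.sum_le_sum_of_subset (Finset.subset_univ _)

/-- A node below the root has fewer descendants than the root, so its class is not the source. -/
theorem topClass_ne_topSource {T : LTree α} {u v : T.Node} (h : u ∈ T.children v) :
    T.topClass u ≠ T.topSource := by
  intro he
  have h1 := (topClass_eq_iff.1 he).size_eq
  have h2 : ∀ w, T.Desc u w := by
    let f : (T.subtree u).Node → (T.subtree T.root).Node := fun w => ⟨w.1, T.reachable w.1⟩
    have hf : Function.Injective f := fun a b hab =>
      Subtype.ext (congrArg (fun x : (T.subtree T.root).Node => x.1) hab)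
    intro w
    obtain ⟨a, ha⟩ := ((Fintype.bijective_iff_injective_and_card f).2 ⟨hf, h1⟩).2
      ⟨w, T.reachable w⟩
    have : a.1 = w := congrArg (fun x : (T.subtree T.root).Node => x.1) ha
    exact this ▸ a.2
  exact T.no_cycle u (Relation.TransGen.tail' (h2 v) h)

theorem topSource_notMem_topOut (T : LTree α) (q : T.TopClass) : T.topSource ∉ T.topOut q := by
  intro h
  obtain ⟨u, hu, he⟩ := List.mem_map.1 h
  exact topClass_ne_topSource hu he

end LTree

/-! ### The order of traversal -/

namespace DagRW

variable {α : Type u}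

/-- The invariant of the traversal, where `done` lists the vertices already output: no vertex
occurs twice among those output or queued, and all these have no edge left to scan. Since a count
that is zero stays zero, they never enter the queue again. -/
def QueueState.Inv {T : LTree α} (done : List T.TopClass) (S : QueueState T) : Prop :=
  (done ++ S.queue).Nodup ∧ ∀ c ∈ done ++ S.queue, S.count c = 0

theorem scanEdge_inv {T : LTree α} {done : List T.TopClass} {S : QueueState T}
    (h : S.Inv done) (c : T.TopClass) :
    (scanEdge S c).val.Inv done ∧ (scanEdge S c).time ≤ 3 := by
  classical
  obtain ⟨h1, h2⟩ := h
  unfold scanEdge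
  by_cases hc : S.count c = 1
  · have hn : c ∉ done ++ S.queue := fun hm => by simp [h2 c hm] at hc
    simp only [Timed.val_bind, Timed.time_bind, hc, if_true, Timed.val_pure, Timed.time_pure,
      Timed.time_tick]
    refine ⟨⟨?_, ?_⟩, le_rfl⟩
    · rw [← List.append_assoc]
      exact h1.append (List.nodup_singleton c) (by simpa using hn)
    · intro d hd
      by_cases hdc : d = c
      · simp [hdc]
      · have : d ∈ done ++ S.queue := by
          simp only [List.mem_append, List.mem_singleton] at hd ⊢
          tauto
        simpa [Function.update_of_ne hdc] using h2 d this
  · simp only [Timed.val_bind, Timed.time_bind, hc, if_false, Timed.val_pure, Timed.time_pure,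
      Timed.time_tick]
    refine ⟨⟨h1, fun d hd => ?_⟩, by simp⟩
    by_cases hdc : d = c
    · subst hdc
      simp [h2 d hd]
    · simpa [Function.update_of_ne hdc] using h2 d hd

/-- The time bound needs no more than the fuel: each iteration scans at most `#T` edges. -/
theorem traverse_spec {T : LTree α} (fuel : ℕ) {done : List T.TopClass} {S : QueueState T}
    (h : S.Inv done) :
    (done ++ (traverse fuel S).val).Nodup ∧ (traverse fuel S).val.length ≤ fuel ∧
      (traverse fuel S).time ≤ fuel * (1 + 3 * T.size) := by
  induction fuel generalizing done S with
  | zero => simpa [traverse] using (List.nodup_append.1 h.1).1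
  | succ fuel ih =>
    obtain ⟨count, queue⟩ := S
    cases queue with
    | nil => simpa [traverse] using (List.nodup_append.1 h.1).1
    | cons q rest =>
      have h0 : QueueState.Inv (done ++ [q]) (⟨count, rest⟩ : QueueState T) := by
        simpa [QueueState.Inv] using h
      obtain ⟨h1, h2⟩ := Timed.foldlM_inv (f := scanEdge) (QueueState.Inv (done ++ [q]))
        (fun _ => 3) (T.topOut q) (fun S hS c _ => scanEdge_inv hS c) _ h0
      obtain ⟨h3, h4, h5⟩ := ih h1
      have h6 := T.outDeg_le q
      simp only [List.map_const', List.sum_replicate, smul_eq_mul] at h2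
      change (T.topOut q).length ≤ _ at h6
      simp only [traverse, Timed.val_bind, Timed.time_bind, Timed.val_pure, Timed.time_pure,
        Timed.time_tick, List.length_cons]
      refine ⟨by simpa using h3, by omega, ?_⟩
      rw [Nat.succ_mul]
      omega

theorem inDegrees_spec (T : LTree α) :
    (inDegrees T).val T.topSource = 0 ∧ (inDegrees T).time ≤ 2 * T.size := by
  classical
  unfold inDegrees
  have key := Timed.foldlM_inv (f := fun (d : T.TopClass → ℕ) (e : T.TopClass × T.TopClass) => do
    Timed.tick 1
    return Function.update d e.2 (d e.2 + 1)) (fun d => d T.topSource = 0) (fun _ => 1)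
    T.topEdges (by
      intro d hd e he
      refine ⟨?_, by simp⟩
      have hne : T.topSource ≠ e.2 := by
        rintro h
        simp only [LTree.topEdges, List.mem_flatMap, List.mem_map] at he
        obtain ⟨q, -, c, hc, rfl⟩ := he
        exact T.topSource_notMem_topOut q (by simpa [h] using hc)
      simpa [Function.update_of_ne hne] using hd) (fun _ => 0) rfl
  refine ⟨key.1, ?_⟩
  have h1 := key.2
  have h2 := T.length_topVertices
  have h3 := T.length_topEdges
  simp only [List.map_const', List.sum_replicate, smul_eq_mul, mul_one] at h1
  simp only [Timed.time_bind, Timed.time_tick]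
  omega

theorem order_spec (T : LTree α) :
    (order T).val.Nodup ∧ (order T).val.length ≤ T.size ∧
      (order T).time ≤ 7 * (T.size * T.size) := by
  obtain ⟨h1, h2⟩ := inDegrees_spec T
  have h0 : QueueState.Inv [] (⟨(inDegrees T).val, [T.topSource]⟩ : QueueState T) := by
    simpa [QueueState.Inv] using h1
  obtain ⟨h3, h4, h5⟩ := traverse_spec T.topVertices.length h0
  have h6 := T.length_topVertices
  have h7 := T.one_le_size
  refine ⟨by simpa [order] using h3, by simpa [order] using h4.trans h6, ?_⟩
  simp only [order, Timed.time_bind, Timed.time_tick]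
  have h8 := Nat.mul_le_mul_right (1 + 3 * T.size) h6
  nlinarith

/-! ### The set of nodes treated at a vertex -/

theorem collectChildren_spec {T : LTree α} (q : T.TopClass) (A : List T.Node) (v : T.Node)
    (hA : A.Nodup ∧ ∀ u ∈ A, T.topClass u = q) :
    ((collectChildren q A v).val.Nodup ∧ ∀ u ∈ (collectChildren q A v).val, T.topClass u = q) ∧
      (collectChildren q A v).time ≤ 4 * T.size := by
  classical
  unfold collectChildren
  have key := Timed.foldlM_inv (f := fun (A : List T.Node) (u : T.Node) => do
    Timed.tick 2
    if T.topClass u = q ∧ u ∉ A then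
      Timed.tick 2
      return u :: A
    else
      return A) (fun A => A.Nodup ∧ ∀ u ∈ A, T.topClass u = q) (fun _ => 4) (T.children v) (by
      rintro A ⟨h1, h2⟩ u -
      by_cases hu : T.topClass u = q ∧ u ∉ A
      · simp [hu, h1]
        exact h2
      · simp [hu, h1]
        exact h2) A hA
  refine ⟨key.1, key.2.trans ?_⟩
  have := LTree.length_le_size (T.nodup_children v)
  simp only [List.map_const', List.sum_replicate, smul_eq_mul]
  omega

open scoped Classical in
/-- The number of edges of a list that enter the vertex `q` of the topological compression. -/
noncomputable def inCount {T : LTree α} (q : T.TopClass) (E : List (Edge T)) : ℕ :=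
  E.countP fun e => e.tgt = Vertex.top q

theorem collect_spec {T : LTree α} (R : Graph T) (q : T.TopClass) :
    ((collect R q).val.Nodup ∧ ∀ u ∈ (collect R q).val, T.topClass u = q) ∧
      (collect R q).time ≤ 1 + R.edges.length + inCount q R.edges * (1 + 4 * T.size) := by
  classical
  unfold collect
  by_cases hq : q = T.topSource
  · subst hq
    simp [LTree.topSource]
    omega
  have key := Timed.foldlM_inv (f := fun (A : List T.Node) (e : Edge T) => do
      Timed.tick 1
      if e.tgt = Vertex.top q then
        Timed.tick 1
        match R.sec e.src with
        | none => return A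
        | some v => collectChildren q A v
      else
        return A) (fun A => A.Nodup ∧ ∀ u ∈ A, T.topClass u = q)
      (fun e => 1 + if e.tgt = Vertex.top q then 1 + 4 * T.size else 0) R.edges (by
      intro A hA e _
      by_cases he : e.tgt = Vertex.top q
      · cases hs : R.sec e.src with
        | none =>
          simp [he, hA.1]
          exact ⟨hA.2, by omega⟩
        | some v =>
          have := collectChildren_spec q A v hA
          simp only [he, if_true, Timed.val_bind, Timed.time_bind, Timed.time_tick]
          exact ⟨this.1, by omega⟩
      · simp [he, hA.1]
        exact hA.2) [] (by simp)
  simp only [hq, if_false, Timed.val_bind, Timed.time_bind, Timed.time_tick]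
  refine ⟨key.1, ?_⟩
  have h2 : (R.edges.map (fun e => 1 + if e.tgt = Vertex.top q then 1 + 4 * T.size else 0)).sum =
      R.edges.length + inCount q R.edges * (1 + 4 * T.size) := by
    unfold inCount
    induction R.edges with
    | nil => simp
    | cons e E ih =>
      simp only [List.map_cons, List.sum_cons, List.length_cons, List.countP_cons, ih]
      by_cases he : e.tgt = Vertex.top q
      · simp [he]; ring
      · simp [he]; ring
  have h1 := key.2
  rw [h2] at h1
  rw [add_assoc]
  exact Nat.add_le_add_left h1 1

end DagRW

/-! ### The partition of the treated nodes -/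

namespace DagRW

variable {α : Type u}

theorem card_idCipher_le (T : LTree α) (u : T.Node) : (idCipher T u).card ≤ T.size := by
  classical
  exact Finset.card_image_le.trans (T.size_subtree_le u)

/-- A cipher returned by the test has at most one pair for each node. -/
theorem card_cipher_le (test : CipherTest α) {T₁ T₂ : LTree α} (h : LTree.TopIso T₁ T₂)
    {f : Cipher α} (hf : (test.run T₁ T₂).val = some f) : f.card ≤ T₁.size := by
  classical
  obtain ⟨φ, -, hφ⟩ := test.sound T₁ T₂ f h hf
  have hsub : f ⊆ (Finset.univ : Finset T₁.Node).image
      fun w => (T₁.label w, T₂.label (φ w)) := by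
    rintro ⟨x, y⟩ hxy
    obtain ⟨w, rfl, rfl⟩ := (hφ x y).1 hxy
    exact Finset.mem_image_of_mem _ (Finset.mem_univ w)
  exact (Finset.card_le_card hsub).trans Finset.card_image_le

/-- The representative of the block lies in the class `q`, and its ciphers have at most `#T`
pairs. -/
def Block.Good {T : LTree α} (q : T.TopClass) (B : Block T) : Prop :=
  T.topClass B.rep = q ∧ ∀ m ∈ B.members, m.2.card ≤ T.size

/-- The total number of members of a list of blocks. -/
def memberCount {T : LTree α} (Bs : List (Block T)) : ℕ :=
  (Bs.map fun B => B.members.length).sum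

theorem insertBlock_spec {T : LTree α} {test : CipherTest α} {C : ℕ → ℕ}
    (hC : test.CostAtMost C) {q : T.TopClass} {u : T.Node} (hu : T.topClass u = q)
    (Bs : List (Block T)) (hBs : ∀ B ∈ Bs, B.Good q) :
    (∀ B ∈ (insertBlock test u Bs).val, B.Good q) ∧
      (insertBlock test u Bs).val.length ≤ Bs.length + 1 ∧
      memberCount (insertBlock test u Bs).val = memberCount Bs + 1 ∧
      (insertBlock test u Bs).time ≤ Bs.length * (1 + C (T.classSize q)) + 3 + T.size := by
  induction Bs with
  | nil =>
    have h1 := T.size_subtree_le u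
    have h2 := card_idCipher_le T u
    simp [insertBlock, memberCount, Block.Good, hu, h2]
    omega
  | cons B Bs ih =>
    obtain ⟨i1, i2, i3, i4⟩ := ih fun B hB => hBs B (by simp [hB])
    obtain ⟨g1, g2⟩ := hBs B (by simp)
    have hiso : LTree.TopIso (T.subtree B.rep) (T.subtree u) :=
      LTree.topClass_eq_iff.1 (g1.trans hu.symm)
    have ht : (test.run (T.subtree B.rep) (T.subtree u)).time ≤ C (T.classSize q) := by
      have := hC _ _ hiso
      rwa [← T.classSize_topClass, g1] at this
    simp only [insertBlock, Timed.val_bind, Timed.time_bind, Timed.time_tick]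
    cases hr : (test.run (T.subtree B.rep) (T.subtree u)).val with
    | none =>
      simp only [Timed.val_bind, Timed.time_bind, Timed.val_pure, Timed.time_pure]
      refine ⟨?_, by simpa using i2, ?_, ?_⟩
      · intro B' hB'
        rcases List.mem_cons.1 hB' with rfl | h
        · exact ⟨g1, g2⟩
        · exact i1 B' h
      · simp only [memberCount, List.map_cons, List.sum_cons] at i3 ⊢
        omega
      · rw [List.length_cons, Nat.succ_mul]
        omega
    | some f =>
      have hf : f.card ≤ T.size := (card_cipher_le test hiso hr).trans (T.size_subtree_le _)
      simp only [Timed.val_bind, Timed.time_bind, Timed.val_pure, Timed.time_pure,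
        Timed.time_tick]
      refine ⟨?_, by simp, ?_, ?_⟩
      · intro B' hB'
        rcases List.mem_cons.1 hB' with rfl | h
        · refine ⟨g1, fun m hm => ?_⟩
          rcases List.mem_append.1 hm with h | h
          · exact g2 m h
          · rw [List.mem_singleton.1 h]
            exact hf
        · exact hBs B' (by simp [h])
      · simp only [memberCount, List.map_cons, List.sum_cons, List.length_append,
          List.length_singleton]
        omega
      · rw [List.length_cons, Nat.succ_mul]
        omega

/-- There are never more blocks than nodes already treated, so each of the `#A` nodes is compared
with at most `#A` representatives. -/
theorem partition_spec {T : LTree α} {test : CipherTest α} {C : ℕ → ℕ}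
    (hC : test.CostAtMost C) {q : T.TopClass} (A : List T.Node)
    (hA : ∀ u ∈ A, T.topClass u = q) :
    (∀ B ∈ (partition test A).val, B.Good q) ∧
      (partition test A).val.length ≤ A.length ∧
      memberCount (partition test A).val = A.length ∧
      (partition test A).time ≤
        A.length * (4 + T.size + A.length * (1 + C (T.classSize q))) := by
  -- `M` is a bound on the number of blocks at every stage, fixed along the induction.
  have key : ∀ (M : ℕ) (l : List T.Node) (Bs : List (Block T)), (∀ u ∈ l, T.topClass u = q) →
      (∀ B ∈ Bs, B.Good q) → Bs.length + l.length ≤ M →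
      let r := l.foldlM (fun Bs u => do
        Timed.tick 1
        insertBlock test u Bs) Bs
      (∀ B ∈ r.val, B.Good q) ∧ r.val.length ≤ Bs.length + l.length ∧
        memberCount r.val = memberCount Bs + l.length ∧
        r.time ≤ l.length * (4 + T.size + M * (1 + C (T.classSize q))) := by
    intro M l
    induction l with
    | nil =>
      intro Bs _ h _
      simpa using h
    | cons u l ih =>
      intro Bs hl hB hM
      obtain ⟨s1, s2, s3, s4⟩ := insertBlock_spec hC (hl u (by simp)) Bs hB
      rw [List.length_cons] at hM
      obtain ⟨t1, t2, t3, t4⟩ := ih _ (fun v hv => hl v (by simp [hv])) s1 (by omega)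
      have h5 : Bs.length * (1 + C (T.classSize q)) ≤ M * (1 + C (T.classSize q)) :=
        Nat.mul_le_mul_right _ (by omega)
      simp only [List.foldlM_cons, Timed.val_bind, Timed.time_bind, Timed.time_tick,
        List.length_cons]
      refine ⟨t1, t2.trans (by omega), by rw [t3, s3]; ring, ?_⟩
      rw [Nat.succ_mul]
      omega
  simpa [partition, memberCount] using key A.length A [] hA (by simp) (by simp)

/-! ### The edges of the edited graph -/

/-- The vertex belongs to the topological compression. -/
def Vertex.IsTop {T : LTree α} (v : Vertex T) : Prop := ∃ q, v = Vertex.top q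

open scoped Classical in
/-- The number of edges of a list that leave the vertex `q` of the topological compression. -/
noncomputable def outCount {T : LTree α} (q : T.TopClass) (E : List (Edge T)) : ℕ :=
  E.countP fun e => e.src = Vertex.top q

open scoped Classical in
/-- The number of edges of a list that enter some vertex of the topological compression. Such an
edge is removed when its target is processed: this is the potential that pays for exploring it. -/
noncomputable def pendingCount {T : LTree α} (E : List (Edge T)) : ℕ :=
  E.countP fun e => e.tgt.IsTop

/-- Only new vertices are identified as classes for tree ciphering. -/
def Graph.IdentNew {T : LTree α} (R : Graph T) : Prop :=
  ∀ v r, R.ident v = some r → ¬ r.IsTop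

/-- `R'` arises from `R` by adding `k` vertices, at most `a` edges in all, and at most `b` edges
that enter the topological compression, none of which leave the topological compression. -/
def Extends {T : LTree α} (R R' : Graph T) (k a b : ℕ) : Prop :=
  R'.vertices.length = R.vertices.length + k ∧ R'.IdentNew ∧
    ∃ L, R'.edges = L ++ R.edges ∧ (∀ e ∈ L, ¬ e.src.IsTop) ∧ L.length ≤ a ∧ pendingCount L ≤ b

theorem Extends.refl {T : LTree α} {R : Graph T} (h : R.IdentNew) : Extends R R 0 0 0 :=
  ⟨rfl, h, [], rfl, by simp, by simp, by simp [pendingCount]⟩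

theorem Extends.trans {T : LTree α} {R₁ R₂ R₃ : Graph T} {k a b k' a' b' : ℕ}
    (h : Extends R₁ R₂ k a b) (h' : Extends R₂ R₃ k' a' b') :
    Extends R₁ R₃ (k + k') (a + a') (b + b') := by
  obtain ⟨h1, -, L, h2, h3, h4, h5⟩ := h
  obtain ⟨h1', h0, L', h2', h3', h4', h5'⟩ := h'
  refine ⟨by omega, h0, L' ++ L, by rw [h2', h2, List.append_assoc], ?_, ?_, ?_⟩
  · intro e he
    rcases List.mem_append.1 he with he | he
    · exact h3' e he
    · exact h3 e he
  · rw [List.length_append]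
    omega
  · unfold pendingCount at *
    rw [List.countP_append]
    omega

theorem Extends.mono {T : LTree α} {R R' : Graph T} {k a b a' b' : ℕ}
    (h : Extends R R' k a b) (ha : a ≤ a') (hb : b ≤ b') : Extends R R' k a' b' := by
  obtain ⟨h1, h0, L, h2, h3, h4, h5⟩ := h
  exact ⟨h1, h0, L, h2, h3, h4.trans ha, h5.trans hb⟩

theorem Extends.outCount_eq {T : LTree α} {R R' : Graph T} {k a b : ℕ}
    (h : Extends R R' k a b) (q : T.TopClass) : outCount q R'.edges = outCount q R.edges := by
  obtain ⟨-, -, L, h2, h3, -, -⟩ := h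
  unfold outCount
  rw [h2, List.countP_append, Nat.add_eq_right, List.countP_eq_zero]
  intro e he hs
  exact h3 e he ⟨q, by simpa using hs⟩

theorem Extends.length_le {T : LTree α} {R R' : Graph T} {k a b : ℕ}
    (h : Extends R R' k a b) : R'.edges.length ≤ R.edges.length + a := by
  obtain ⟨-, -, L, h2, -, h4, -⟩ := h
  rw [h2, List.length_append]
  omega

theorem Extends.addEdge {T : LTree α} {R : Graph T} (h : R.IdentNew) (e : Edge T)
    (he : ¬ e.src.IsTop) : Extends R { R with edges := e :: R.edges } 0 1 1 :=
  ⟨rfl, h, [e], rfl, by simpa using he, by simp, List.countP_le_length⟩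

theorem Extends.addEdge_new {T : LTree α} {R : Graph T} (h : R.IdentNew) (e : Edge T)
    (he : ¬ e.src.IsTop) (ht : ¬ e.tgt.IsTop) :
    Extends R { R with edges := e :: R.edges } 0 1 0 :=
  ⟨rfl, h, [e], rfl, by simpa using he, by simp, by simp [pendingCount, ht]⟩

theorem not_isTop_new {T : LTree α} (v : T.Node) : ¬ (Vertex.new v).IsTop := by
  rintro ⟨q, h⟩
  cases h

/-- The edges copied from `q` are the only new ones that may enter the topological compression;
the others enter the new vertex of `P`. -/
theorem addBlock_spec {T : LTree α} {q : T.TopClass} {R : Graph T} {P : Block T}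
    (hR : R.IdentNew) (hP : P.Good q) :
    Extends R (addBlock q R P).val 1 (outCount q R.edges + P.members.length)
        (outCount q R.edges) ∧
      (addBlock q R P).time ≤ 4 + 2 * R.edges.length + P.members.length * (3 + T.size) := by
  classical
  -- The loop that copies the edges leaving `q`; `r` stands for the new vertex.
  have copy : ∀ (r : Vertex T), ¬ r.IsTop → ∀ (E : List (Edge T)) (S : Graph T), S.IdentNew →
      let x := E.foldlM (fun R' e => do
        Timed.tick 1
        if e.src = Vertex.top q then
          Timed.tick 1
          return { R' with edges := ⟨r, e.tgt, none⟩ :: R'.edges }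
        else
          return R') S
      Extends S x.val 0 (outCount q E) (outCount q E) ∧ x.time ≤ 2 * E.length := by
    intro r hr E
    induction E with
    | nil =>
      intro S hS
      exact ⟨Extends.refl hS, by simp⟩
    | cons e E ih =>
      intro S hS
      by_cases he : e.src = Vertex.top q
      · have h1 := Extends.addEdge hS ⟨r, e.tgt, none⟩ hr
        obtain ⟨h2, h3⟩ := ih _ h1.2.1
        simp only [List.foldlM_cons, Timed.val_bind, Timed.time_bind, Timed.time_tick, he, if_true,
          Timed.val_pure, Timed.time_pure]
        have hc : outCount q (e :: E) = 1 + outCount q E := by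
          simp [outCount, he, add_comm]
        rw [hc, List.length_cons]
        exact ⟨by simpa using h1.trans h2, by omega⟩
      · obtain ⟨h2, h3⟩ := ih _ hS
        simp only [List.foldlM_cons, Timed.val_bind, Timed.time_bind, Timed.time_tick, he, if_false,
          Timed.val_pure, Timed.time_pure]
        have hc : outCount q (e :: E) = outCount q E := by
          simp [outCount, he]
        rw [hc, List.length_cons]
        exact ⟨h2, by omega⟩
  -- The loop that adds an edge to `r` for each member of the block.
  have link : ∀ (r : Vertex T), ¬ r.IsTop → ∀ (l : List (T.Node × Cipher α)),
      (∀ m ∈ l, m.2.card ≤ T.size) → ∀ (S : Graph T), S.IdentNew →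
      let x := l.foldlM (fun R' m => do
        Timed.tick 2
        match (T.parent m.1).bind R'.ident with
        | none => return R'
        | some p =>
          Timed.tick (1 + m.2.card)
          return { R' with edges := ⟨p, r, some m.2⟩ :: R'.edges }) S
      Extends S x.val 0 l.length 0 ∧ x.time ≤ l.length * (3 + T.size) := by
    intro r hr l
    induction l with
    | nil =>
      intro _ S hS
      exact ⟨Extends.refl hS, by simp⟩
    | cons m l ih =>
      intro hl S hS
      have ih' := ih fun m hm => hl m (by simp [hm])
      have hm := hl m (by simp)
      simp only [List.foldlM_cons, Timed.val_bind, Timed.time_bind, Timed.time_tick,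
        List.length_cons, Nat.succ_mul]
      cases hp : (T.parent m.1).bind S.ident with
      | none =>
        obtain ⟨h2, h3⟩ := ih' _ hS
        simp only [Timed.val_pure, Timed.time_pure]
        exact ⟨h2.mono (by omega) le_rfl, by omega⟩
      | some p =>
        have hpn : ¬ p.IsTop := by
          obtain ⟨v, -, hv⟩ := Option.bind_eq_some_iff.1 hp
          exact hS v p hv
        have h1 := Extends.addEdge_new hS ⟨p, r, some m.2⟩ hpn hr
        obtain ⟨h2, h3⟩ := ih' _ h1.2.1
        simp only [Timed.val_bind, Timed.time_bind, Timed.time_tick,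
          Timed.val_pure, Timed.time_pure]
        exact ⟨(h1.trans h2).mono (by omega) le_rfl, by omega⟩
  have hnew := not_isTop_new (T := T) P.rep
  let R₁ : Graph T := { R with
    vertices := Vertex.new P.rep :: R.vertices
    label := Function.update R.label (Vertex.new P.rep) (some (T.label P.rep))
    ident := Function.update R.ident P.rep (some (Vertex.new P.rep)) }
  have h1 : Extends R R₁ 1 0 0 := by
    refine ⟨rfl, ?_, [], rfl, by simp, by simp, by simp [pendingCount]⟩
    intro v r hv
    by_cases h : v = P.rep
    · subst h
      have : Vertex.new P.rep = r := by simpa [R₁] using hv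
      exact this ▸ hnew
    · exact hR v r (by simpa [R₁, Function.update_of_ne h] using hv)
  obtain ⟨h2, t2⟩ := copy _ hnew R₁.edges R₁ h1.2.1
  obtain ⟨h3, t3⟩ := link _ hnew P.members hP.2 _ h2.2.1
  have h4 := (h1.trans h2).trans h3
  unfold addBlock
  simp only [Timed.val_bind, Timed.time_bind, Timed.time_tick, Timed.val_pure, Timed.time_pure]
  constructor
  · have h5 := h4.mono (a' := outCount q R.edges + P.members.length)
      (b' := outCount q R.edges) (by simp [R₁]) (by simp [R₁])
    exact h5
  · have t4 := Nat.add_le_add (Nat.add_le_add (Nat.le_refl 3) t2)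
      (Nat.add_le_add t3 (Nat.le_refl 1))
    refine le_trans (le_of_eq (add_assoc 3 _ _).symm) (t4.trans (le_of_eq ?_))
    simp only [R₁]
    ring

/-- The new edges do not leave `q`, so every block copies the same number of edges; `M` bounds the
number of edges present at any moment of the loop. -/
theorem foldlM_addBlock_spec {T : LTree α} {q : T.TopClass} (Ps : List (Block T))
    (hPs : ∀ P ∈ Ps, P.Good q) (R : Graph T) (hR : R.IdentNew) (M : ℕ)
    (hM : R.edges.length + Ps.length * outCount q R.edges + memberCount Ps ≤ M) :
    Extends R (Ps.foldlM (addBlock q) R).val Ps.length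
        (Ps.length * outCount q R.edges + memberCount Ps) (Ps.length * outCount q R.edges) ∧
      (Ps.foldlM (addBlock q) R).time ≤
        Ps.length * (4 + 2 * M) + memberCount Ps * (3 + T.size) := by
  induction Ps generalizing R with
  | nil => simpa [memberCount] using Extends.refl hR
  | cons P Ps ih =>
    obtain ⟨h1, t1⟩ := addBlock_spec hR (hPs P (by simp))
    have hc : memberCount (P :: Ps) = P.members.length + memberCount Ps := rfl
    rw [hc, List.length_cons, Nat.succ_mul] at hM
    have hl := h1.length_le
    obtain ⟨h2, t2⟩ := ih (fun P hP => hPs P (by simp [hP])) _ h1.2.1 (by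
      rw [h1.outCount_eq]
      omega)
    rw [h1.outCount_eq] at h2
    rw [hc, List.length_cons, Nat.succ_mul, Nat.succ_mul, add_mul]
    simp only [List.foldlM_cons, Timed.val_bind, Timed.time_bind]
    refine ⟨?_, by omega⟩
    have h3 := (h1.trans h2).mono
      (a' := Ps.length * outCount q R.edges + outCount q R.edges +
        (P.members.length + memberCount Ps))
      (b' := Ps.length * outCount q R.edges + outCount q R.edges) (by omega) (by omega)
    rwa [add_comm 1] at h3

end DagRW

/-! ### The main loop -/

namespace DagRW

variable {α : Type u}

/-- The invariant of the main loop, where `qs` lists the vertices still to be processed. Each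
processed vertex `q` accounts for at most `m` new vertices and `m * (outDeg q + 1)` new edges, with
`m = classCard q`; so the shares of the vertices in `qs` remain available. -/
structure Graph.LoopInv {T : LTree α} (qs : List T.TopClass) (R : Graph T) : Prop where
  identNew : R.IdentNew
  outCount_le : ∀ p, outCount p R.edges ≤ T.outDeg p
  length_vertices_le : R.vertices.length + (qs.map T.classCard).sum ≤ 2 * T.size
  length_edges_le :
    R.edges.length + (qs.map fun q => T.classCard q * (T.outDeg q + 1)).sum ≤ 3 * T.size

theorem outCount_filter_le {T : LTree α} (p : T.TopClass) (f : Edge T → Bool) (E : List (Edge T)) :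
    outCount p (E.filter f) ≤ outCount p E :=
  List.Sublist.countP_le List.filter_sublist

open scoped Classical in
/-- Deleting the edges at `q` releases the potential of the edges that enter `q`. -/
theorem pendingCount_filter_add_inCount_le {T : LTree α} (q : T.TopClass) (L E : List (Edge T)) :
    pendingCount ((L ++ E).filter fun e => e.src ≠ Vertex.top q ∧ e.tgt ≠ Vertex.top q) +
      inCount q E ≤ pendingCount L + pendingCount E := by
  rw [List.filter_append]
  unfold pendingCount inCount
  rw [List.countP_append, add_assoc]
  refine Nat.add_le_add (List.Sublist.countP_le List.filter_sublist) ?_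
  induction E with
  | nil => simp
  | cons e E ih =>
    by_cases ht : e.tgt = Vertex.top q
    · have : e.tgt.IsTop := ⟨q, ht⟩
      simp only [List.filter_cons, ht, List.countP_cons] at ih ⊢
      simp [← ht, this] at ih ⊢
      omega
    · by_cases hs : e.src = Vertex.top q <;> by_cases hp : e.tgt.IsTop <;>
      · simp [ht, hs, hp] at ih ⊢
        omega

/-- Amortised cost of one iteration: with `5 * #T` steps of credit for each pending edge, the edges
that enter `q` pay for their own exploration. -/
theorem processVertex_spec {T : LTree α} {test : CipherTest α} {C : ℕ → ℕ}
    (hC : test.CostAtMost C) (hC1 : ∀ q, 1 ≤ C (T.classSize q)) {q : T.TopClass}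
    {qs : List T.TopClass} {R : Graph T} (hR : R.LoopInv (q :: qs)) :
    (processVertex test R q).val.LoopInv qs ∧
      (processVertex test R q).time +
          5 * T.size * pendingCount (processVertex test R q).val.edges ≤
        5 * T.size * pendingCount R.edges + 10 * T.size +
          (21 * T.size * (T.classCard q * C (T.classSize q)) +
            5 * T.size * (T.classCard q * T.outDeg q)) := by
  classical
  obtain ⟨r1, r2, r3, r4⟩ := hR
  obtain ⟨⟨a1, a2⟩, a3⟩ := collect_spec R q
  have a4 := LTree.length_le_classCard a1 a2
  obtain ⟨b1, b2, b3, b4⟩ := partition_spec hC _ a2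
  simp only [List.map_cons, List.sum_cons] at r3 r4
  have hN := T.one_le_size
  have hmN := T.classCard_le q
  have hC1 := hC1 q
  have hq := r2 q
  unfold processVertex
  simp only [Timed.val_bind_fun, Timed.time_bind_fun, Timed.val_bind, Timed.time_bind,
    Timed.time_tick]
  generalize (collect R q).val = A at *
  generalize (partition test A).val = Ps at *
  generalize C (T.classSize q) = c at *
  have e1 : Ps.length * outCount q R.edges ≤ T.classCard q * T.outDeg q :=
    Nat.mul_le_mul (b2.trans a4) hq
  rw [Nat.mul_succ] at r4
  obtain ⟨d1, d2⟩ := foldlM_addBlock_spec Ps b1 R r1 (3 * T.size) (by omega)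
  generalize Ps.foldlM (addBlock q) R = X at *
  have d3 := d1.length_le
  have d4 := fun p => (d1.outCount_eq p).trans_le (r2 p)
  obtain ⟨v1, v2, L, v3, -, v4, v5⟩ := d1
  have hpot := pendingCount_filter_add_inCount_le q L R.edges
  rw [← v3] at hpot
  have hfv := List.length_filter_le (fun v : Vertex T => decide (v ≠ Vertex.top q)) X.val.vertices
  have hfe := List.length_filter_le
    (fun e : Edge T => decide (e.src ≠ Vertex.top q ∧ e.tgt ≠ Vertex.top q)) X.val.edges
  unfold deleteVertex
  simp only [Timed.val_bind, Timed.time_bind, Timed.time_tick, Timed.val_pure, Timed.time_pure]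
  constructor
  · refine ⟨v2, fun p => (outCount_filter_le p _ _).trans (d4 p), ?_, ?_⟩
    · refine le_trans (Nat.add_le_add_right hfv _) ?_
      omega
    · refine le_trans (Nat.add_le_add_right hfe _) ?_
      omega
  · have hpot' := Nat.mul_le_mul_left (5 * T.size) (hpot.trans (Nat.add_le_add_right
      (v5.trans e1) _))
    generalize pendingCount (X.val.edges.filter _) = Φ' at *
    generalize pendingCount R.edges = Φ at *
    generalize inCount q R.edges = k at *
    have hV : X.val.vertices.length + X.val.edges.length ≤ 5 * T.size := by omega
    have hE : R.edges.length ≤ 3 * T.size := by omega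
    generalize T.size = N at *
    generalize T.classCard q = m at *
    generalize T.outDeg q = o at *
    rw [b3] at d2
    have x1 : k * (1 + 4 * N) ≤ 5 * N * k := by
      rw [mul_comm (5 * N)]
      exact Nat.mul_le_mul_left k (by omega)
    -- Every term is compared with `N * (m * c)`.
    have hmc : m ≤ m * c := Nat.le_mul_of_pos_right _ hC1
    have hNm : m ≤ N * m := Nat.le_mul_of_pos_left _ hN
    have hNmc : N * m ≤ N * (m * c) := Nat.mul_le_mul_left _ hmc
    have x2 : A.length * (4 + N + A.length * (1 + c)) ≤ 7 * (N * (m * c)) := by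
      have h := Nat.mul_le_mul a4 (Nat.add_le_add_left (Nat.mul_le_mul_right (1 + c)
        (a4.trans hmN)) (4 + N))
      rw [show m * (4 + N + N * (1 + c)) = 4 * m + 2 * (N * m) + N * (m * c) by ring] at h
      omega
    have x3 : Ps.length * (4 + 2 * (3 * N)) ≤ 10 * (N * (m * c)) := by
      have h := Nat.mul_le_mul_right (4 + 2 * (3 * N)) (b2.trans a4)
      rw [show m * (4 + 2 * (3 * N)) = 4 * m + 6 * (N * m) by ring] at h
      omega
    have x4 : A.length * (3 + N) ≤ 4 * (N * (m * c)) := by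
      have h := Nat.mul_le_mul_right (3 + N) a4
      rw [show m * (3 + N) = 3 * m + N * m by ring] at h
      omega
    rw [mul_add, mul_add] at hpot'
    rw [mul_assoc 21]
    omega

theorem foldlM_processVertex_time_le {T : LTree α} {test : CipherTest α} {C : ℕ → ℕ}
    (hC : test.CostAtMost C) (hC1 : ∀ q, 1 ≤ C (T.classSize q)) (qs : List T.TopClass)
    (R : Graph T) (hR : R.LoopInv qs) :
    (qs.foldlM (processVertex test) R).time ≤
      5 * T.size * pendingCount R.edges + qs.length * (10 * T.size) +
        (qs.map fun q => 21 * T.size * (T.classCard q * C (T.classSize q)) +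
            5 * T.size * (T.classCard q * T.outDeg q)).sum := by
  induction qs generalizing R with
  | nil => simp
  | cons q qs ih =>
    obtain ⟨h1, h2⟩ := processVertex_spec hC hC1 hR
    have h3 := ih _ h1
    simp only [List.foldlM_cons, Timed.time_bind, List.map_cons, List.sum_cons, List.length_cons,
      Nat.succ_mul qs.length]
    omega

/-- The initial graph has the invariant for every list of vertices without repetition. -/
theorem init_spec {T : LTree α} {qs : List T.TopClass} (hqs : qs.Nodup) :
    (init T).val.LoopInv qs ∧ (init T).val.edges.length ≤ T.size ∧
      (init T).time ≤ 2 * T.size := by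
  classical
  have h1 := T.length_topVertices
  have h2 := T.length_topEdges
  refine ⟨⟨?_, ?_, ?_, ?_⟩, ?_, ?_⟩
  · intro v r h
    cases h
  · intro p
    refine le_trans (le_of_eq ?_) (T.countP_topEdges p).le
    simp [outCount, init, List.countP_map, Function.comp_def]
  · have h3 := T.sum_map_le_sum hqs T.classCard
    rw [T.sum_classCard] at h3
    have : (init T).val.vertices.length = T.topVertices.length := by simp [init]
    omega
  · have h3 := T.sum_map_le_sum hqs fun q => T.classCard q * (T.outDeg q + 1)
    simp only [mul_add, mul_one, Finset.sum_add_distrib, T.sum_classCard] at h3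
    have h4 := T.sum_classCard_mul_outDeg_le
    have : (init T).val.edges.length = T.topEdges.length := by simp [init]
    simp only [mul_add, mul_one]
    omega
  · simpa [init] using h2
  · simp only [init, Timed.time_bind, Timed.time_tick, Timed.time_pure]
    omega

theorem dagRW_time_le {T : LTree α} {test : CipherTest α} {C : ℕ → ℕ} (hC : test.CostAtMost C) :
    (dagRW test T).time ≤ 50 * (T.size * ∑ v, C (T.subtree v).size) := by
  have hpos : ∀ v, 1 ≤ C (T.subtree v).size := fun v =>
    (test.one_le_time _ _ (LTree.TopIso.refl _)).trans (hC _ _ (LTree.TopIso.refl _))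
  obtain ⟨o1, o2, o3⟩ := order_spec T
  obtain ⟨i1, i2, i3⟩ := init_spec o1
  have h1 := foldlM_processVertex_time_le hC (fun q => hpos _) _ _ i1
  have h2 := T.sum_map_le_sum o1 fun q =>
    21 * T.size * (T.classCard q * C (T.classSize q)) + 5 * T.size * (T.classCard q * T.outDeg q)
  rw [Finset.sum_add_distrib, ← Finset.mul_sum, ← Finset.mul_sum,
    T.sum_classCard_mul fun q => C (T.classSize q)] at h2
  simp only [LTree.classSize_topClass] at h2
  have h3 := T.sum_classCard_mul_outDeg_le
  have hS : T.size ≤ ∑ v, C (T.subtree v).size := by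
    simpa [LTree.size] using Finset.sum_le_sum fun v (_ : v ∈ Finset.univ) => hpos v
  have hN := T.one_le_size
  have h4 : pendingCount (init T).val.edges ≤ T.size := List.countP_le_length.trans i2
  unfold dagRW
  simp only [Timed.time_bind_fun, Timed.time_bind]
  generalize ∑ v, C (T.subtree v).size = S at *
  -- The constant: `7` for the order, `2` for the initial graph, and `5 + 10 + 21 + 5` for the loop.
  have e1 := Nat.mul_le_mul_left (5 * T.size) h4
  have e2 := Nat.mul_le_mul_right (10 * T.size) o2
  have e3 := Nat.mul_le_mul_left (5 * T.size) h3
  have e4 : T.size ≤ T.size * T.size := Nat.le_mul_of_pos_left _ hN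
  have e5 : T.size * T.size ≤ T.size * S := Nat.mul_le_mul_left _ hS
  have e6 : T.size * (10 * T.size) = 10 * (T.size * T.size) := by ring
  simp only [mul_assoc] at e1 e3
  rw [mul_assoc 21] at h2
  rw [mul_assoc 5] at h1 h2
  omega

end DagRW

/-! ### The bound in terms of the distinct subtrees -/

theorem mainTheorem7 :
    ∃ K : ℕ, ∀ (α : Type u) (test : CipherTest α) (C : ℕ → ℕ), test.CostAtMost C →
      ∀ (T : LTree α) (n : ℕ) (rep : Fin n → T.Node) (s m : Fin n → ℕ),
        (∀ v : T.Node, ∃! i, LTree.TopIso (T.subtree v) (T.subtree (rep i))) →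
        (∀ i, s i = (T.subtree (rep i)).size) →
        (∀ i, m i = Nat.card {v : T.Node // LTree.TopIso (T.subtree v) (T.subtree (rep i))}) →
        (DagRW.dagRW test T).time ≤ K * (T.size * ∑ i, m i * C (s i)) := by
  classical
  refine ⟨50, fun α test C hC T n rep s m hrep hs hm => ?_⟩
  convert DagRW.dagRW_time_le hC (T := T) using 3
  choose i hi hu using hrep
  rw [← Finset.sum_fiberwise_of_maps_to (g := i) (t := Finset.univ) (by simp)]
  refine Finset.sum_congr rfl fun j _ => ?_
  have hiff : ∀ v, i v = j ↔ LTree.TopIso (T.subtree v) (T.subtree (rep j)) := fun v =>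
    ⟨fun h => h ▸ hi v, fun h => (hu v j h).symm⟩
  rw [Finset.sum_congr rfl (g := fun _ => C (s j))]
  · rw [Finset.sum_const, smul_eq_mul, hm, Nat.card_eq_fintype_card, Fintype.card_subtype]
    simp only [hiff]
  · intro v hv
    rw [hs, ((hiff v).1 (Finset.mem_filter.1 hv).2).size_eq]
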